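/- Let $\mathcal H=(\mathbb C^2)^{\otimes n}$ and let $H_1,\dots,H_K$ be Hermitian operators on $\mathcal H$. A layer is $U_1(\theta)=e^{-i\theta_1H_1}\cdots e^{-i\theta_KH_K}$, $\theta\in\mathbb R^K$, and an $L$-layered circuit ($L\ge 1$) is $U(\vec\theta)=U_1(\theta^{(L)})\cdots U_1(\theta^{(1)})$, where $\theta^{(1)},\dots,\theta^{(L)}\in\mathbb R^K$ are drawn independently from one probability law $\nu$ on $\mathbb R^K$; let $\mathcal E_L$ be the resulting ensemble of unitaries. Assume that the set of $\theta\in\mathbb R^K$ for which $U_1(\theta)$ lies in the support of the law of $\mathcal E_1$ has positive Lebesgue measure (for example, $\nu$ has a density, or the law of $\mathcal E_1$ charges every nonempty relatively open subset of $\{U_1(\theta):\theta\in\mathbb R^K\}$). Let $\mathfrak g$ be the real Lie algebra generated by $iH_1,\dots,iH_K$ and let $G$ be the closed subgroup of the unitary group generated by $e^{\mathfrak g}$ (so $G=e^{\mathfrak g}$ whenever $e^{\mathfrak g}$ is a compact group), with normalized Haar measure. For an ensemble $\mathcal E$ of unitaries with law $\mu$ and $t\in\mathbb N$ let $\mathcal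 M^{(t)}_{\mathcal E}(A)=\int U^{\otimes t}A(U^\dagger)^{\otimes t}\,d\mu(U)$ on operators $A$ on $\mathcal H^{\otimes t}$, let $\mathcal M_G^{(t)}$ be the moment operator of the Haar ensemble, and $\mathcal A^{(t)}_{\mathcal E}=\mathcal M^{(t)}_{\mathcal E}-\mathcal M^{(t)}_G$. Let $\|\cdot\|_\infty$ be the Schatten $\infty$-norm of superoperators, i.e. the largest singular value with respect to the Hilbert–Schmidt inner product. Then: 1. every circuit $U(\vec\theta)$ lies in $G$; 2. $\|\mathcal A^{(t)}_{\mathcal E_1}\|_\infty<1$; 3. for every $\epsilon>0$ and every $L\ge1$ with $$L\ \ge\ \frac{\log(1/\epsilon)}{\log\bigl(1/\|\mathcal A^{(t)}_{\mathcal E_1}\|_\infty\bigr)}$$ the ensemble $\mathcal E_L$ is an $\epsilon$-approximate $t$-design over $G$, i.e. $\|\mathcal A^{(t)}_{\mathcal E_L}\|_\infty\le\epsilon$ (the right-hand side is read as $0$ if $\mathcal A^{(t)}_{\mathcal E_1}=0$); 4. for every $L\ge1$, $\mathcal A^{(t)}_{\mathcal E_L}=\bigl(\mathcal A^{(t)}_{\mathcal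 E_1}\bigr)^{L}$ and $\|\mathcal A^{(t)}_{\mathcal E_L}\|_\infty\le\|\mathcal A^{(t)}_{\mathcal E_1}\|_\infty^{L}$, with equality whenever $\mathcal M^{(t)}_{\mathcal E_1}$ is self-adjoint for the Hilbert–Schmidt inner product; 5. statement 3 also holds when $\|\cdot\|_\infty$ is replaced throughout by the induced norm $\|\Phi\|=\sup_{A\ne0}\|\Phi(A)\|_\infty/\|A\|_\infty$, where $\|A\|_\infty$ is the largest singular value of the operator $A$, provided that $\|\mathcal A^{(t)}_{\mathcal E_1}\|<1$ in this norm (so that the logarithm in the denominator is positive). -/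

import Mathlib

open MeasureTheory

namespace PQC

noncomputable section

/-! ### The unitary group `U(d)` as a compact group with its Borel σ-algebra -/

section UnitaryGroup

variable {d : Type*} [Fintype d] [DecidableEq d]

instance : MeasurableSpace (Matrix.unitaryGroup d ℂ) := borel _

instance : BorelSpace (Matrix.unitaryGroup d ℂ) := ⟨rfl⟩

instance : CompactSpace (Matrix.unitaryGroup d ℂ) := by
  suffices h : IsCompact ((Matrix.unitaryGroup d ℂ : Submonoid (Matrix d d ℂ)) :
      Set (Matrix d d ℂ)) from isCompact_iff_compactSpace.mp h
  have hK : IsCompact (Set.pi Set.univ fun _ : d => Set.pi Set.univ fun _ : d =>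
      Metric.closedBall (0 : ℂ) 1) :=
    isCompact_univ_pi fun _ => isCompact_univ_pi fun _ => isCompact_closedBall _ _
  refine IsCompact.of_isClosed_subset (s := (Set.pi Set.univ fun _ : d =>
    Set.pi Set.univ fun _ : d => Metric.closedBall (0 : ℂ) 1 : Set (Matrix d d ℂ))) hK ?_ ?_
  · have : ((Matrix.unitaryGroup d ℂ : Submonoid (Matrix d d ℂ)) : Set (Matrix d d ℂ))
        = {A | star A * A = 1} ∩ {A | A * star A = 1} := by
      exact Set.ext fun A => Unitary.mem_iff
    rw [this]
    exact (isClosed_eq (by fun_prop) continuous_const).inter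
      (isClosed_eq (by fun_prop) continuous_const)
  · intro A hA i _ j _
    simpa using entry_norm_bound_of_unitary hA i j

end UnitaryGroup

/-! ### Moment operators -/

section Moments

variable {d : Type*} [Fintype d] [DecidableEq d]

/-- The `t`-fold tensor power `U^{⊗t}`, acting on `(ℂ^d)^{⊗t}`, whose standard basis is indexed by
`Fin t → d`. -/
def tensorPow (t : ℕ) (U : Matrix d d ℂ) : Matrix (Fin t → d) (Fin t → d) ℂ :=
  Matrix.of fun i j => ∏ s, U (i s) (j s)

/-- `U^{⊗t} A (U†)^{⊗t}`. -/
def conjTensor (t : ℕ) (U : Matrix.unitaryGroup d ℂ) (A : Matrix (Fin t → d) (Fin t → d) ℂ) :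
    Matrix (Fin t → d) (Fin t → d) ℂ :=
  tensorPow t (U : Matrix d d ℂ) * A * tensorPow t (star (U : Matrix d d ℂ))

theorem continuous_conjTensor_apply (t : ℕ) (A : Matrix (Fin t → d) (Fin t → d) ℂ)
    (i j : Fin t → d) :
    Continuous fun U : Matrix.unitaryGroup d ℂ => conjTensor t U A i j := by
  have h1 : ∀ i j, Continuous fun U : Matrix.unitaryGroup d ℂ => (U : Matrix d d ℂ) i j :=
    fun i j => continuous_subtype_val.matrix_elem i j
  simp only [conjTensor, tensorPow, Matrix.mul_apply, Matrix.of_apply, Matrix.star_apply]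
  exact continuous_finsetSum _ fun k _ => (continuous_finsetSum _ fun l _ =>
    (continuous_finsetProd _ fun s _ => h1 _ _).mul continuous_const).mul
      (continuous_finsetProd _ fun s _ => (h1 _ _).star)

theorem integrable_conjTensor_apply (t : ℕ) (μ : Measure (Matrix.unitaryGroup d ℂ))
    [IsFiniteMeasure μ] (A : Matrix (Fin t → d) (Fin t → d) ℂ) (i j : Fin t → d) :
    Integrable (fun U : Matrix.unitaryGroup d ℂ => conjTensor t U A i j) μ :=
  (continuous_conjTensor_apply t A i j).integrable_of_hasCompactSupport
    (HasCompactSupport.of_compactSpace _)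

/-- The `t`-th moment operator `A ↦ ∫ U^{⊗t} A (U†)^{⊗t} dμ(U)` of an ensemble of unitaries with
law `μ`; the integral of the matrix-valued function is taken entry by entry. -/
def moment (t : ℕ) (μ : Measure (Matrix.unitaryGroup d ℂ)) [IsFiniteMeasure μ] :
    Module.End ℂ (Matrix (Fin t → d) (Fin t → d) ℂ) where
  toFun A := Matrix.of fun i j => ∫ U, conjTensor t U A i j ∂μ
  map_add' A B := by
    ext i j
    simp only [Matrix.of_apply, Matrix.add_apply]
    rw [← integral_add (integrable_conjTensor_apply t μ A i j)
      (integrable_conjTensor_apply t μ B i j)]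
    simp [conjTensor, Matrix.mul_add, Matrix.add_mul]
  map_smul' c A := by
    ext i j
    simp only [Matrix.of_apply, Matrix.smul_apply, RingHom.id_apply, smul_eq_mul]
    rw [← integral_const_mul]
    simp [conjTensor]

end Moments

/-! ### Norms of operators and of superoperators -/

section Norms

variable {m : Type*} [Fintype m] [DecidableEq m]

/-- The Hilbert–Schmidt (Schatten 2-) norm of a matrix. -/
def hsNorm (A : Matrix m m ℂ) : ℝ :=
  √(∑ i, ∑ j, ‖A i j‖ ^ 2)

/-- The Schatten `∞`-norm of a matrix, i.e. its largest singular value. -/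
def schattenInfty (A : Matrix m m ℂ) : ℝ :=
  ‖Matrix.toEuclideanCLM (n := m) (𝕜 := ℂ) A‖

/-- The norm `sup_{A ≠ 0} N (Φ A) / N A` of a superoperator induced by a norm `N` on matrices. -/
def inducedNorm (N : Matrix m m ℂ → ℝ) (Φ : Module.End ℂ (Matrix m m ℂ)) : ℝ :=
  sSup {r | ∃ A, A ≠ 0 ∧ r = N (Φ A) / N A}

/-- The Schatten `∞`-norm of a superoperator `Φ`: the largest singular value of `Φ` as an operator
on the Hilbert space of matrices with the Hilbert–Schmidt inner product. -/
def superNorm (Φ : Module.End ℂ (Matrix m m ℂ)) : ℝ :=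
  inducedNorm hsNorm Φ

/-- The norm of a superoperator induced by the Schatten `∞`-norm on matrices. -/
def superNormInd (Φ : Module.End ℂ (Matrix m m ℂ)) : ℝ :=
  inducedNorm schattenInfty Φ

/-- Self-adjointness of a superoperator for the Hilbert–Schmidt inner product `Tr (A† B)`. -/
def IsHSSelfAdjoint (Φ : Module.End ℂ (Matrix m m ℂ)) : Prop :=
  ∀ A B : Matrix m m ℂ, ((Φ A).conjTranspose * B).trace = (A.conjTranspose * Φ B).trace

end Norms

/-! ### The circuit, its dynamical Lie algebra, and its group -/

section Circuit

variable {d : Type*} [Fintype d] [DecidableEq d] {K : ℕ}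

-- matrices with the commutator bracket
attribute [local instance] LieRing.ofAssociativeRing

/-- The gate `e^{-i θ H}`. -/
def gate (H : selfAdjoint (Matrix d d ℂ)) (θ : ℝ) : Matrix.unitaryGroup d ℂ :=
  ⟨NormedSpace.exp ((-Complex.I * (θ : ℂ)) • (H : Matrix d d ℂ)), by
    rw [Matrix.mem_unitaryGroup_iff, Matrix.star_eq_conjTranspose, ← Matrix.exp_conjTranspose,
      ← Matrix.exp_add_of_commute]
    · have hH : (H : Matrix d d ℂ).conjTranspose = H := H.2
      simp [Matrix.conjTranspose_smul, hH]
    · have hH : (H : Matrix d d ℂ).conjTranspose = H := H.2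
      rw [Matrix.conjTranspose_smul, hH]
      exact ((Commute.refl _).smul_left _).smul_right _⟩

/-- One layer `e^{-i θ₁ H₁} ⋯ e^{-i θ_K H_K}`. -/
def layer (H : Fin K → selfAdjoint (Matrix d d ℂ)) (θ : Fin K → ℝ) : Matrix.unitaryGroup d ℂ :=
  (List.ofFn fun k => gate (H k) (θ k)).prod

/-- The `L`-layered circuit `U_L(θ_L) ⋯ U_1(θ_1)`; all layers have the same gates. -/
def circuit (H : Fin K → selfAdjoint (Matrix d d ℂ)) {L : ℕ} (Θ : Fin L → Fin K → ℝ) :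
    Matrix.unitaryGroup d ℂ :=
  (List.ofFn fun l => layer H (Θ l)).reverse.prod

/-- The law of the ensemble `E_L`: the parameters of the `L` layers are independent, those of each
layer being drawn from the law `ν` on `ℝ^K`. -/
def ensemble (H : Fin K → selfAdjoint (Matrix d d ℂ)) (ν : Measure (Fin K → ℝ)) (L : ℕ) :
    Measure (Matrix.unitaryGroup d ℂ) :=
  (Measure.pi fun _ : Fin L => ν).map (circuit H)

instance (H : Fin K → selfAdjoint (Matrix d d ℂ)) (ν : Measure (Fin K → ℝ))
    [IsProbabilityMeasure ν] (L : ℕ) : IsFiniteMeasure (ensemble H ν L) := by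
  unfold ensemble; infer_instance

/-- The dynamical Lie algebra: the real Lie algebra generated by `i H₁, …, i H_K`. -/
def dynLie (H : Fin K → selfAdjoint (Matrix d d ℂ)) : LieSubalgebra ℝ (Matrix d d ℂ) :=
  LieSubalgebra.lieSpan ℝ (Matrix d d ℂ) (Set.range fun k => Complex.I • (H k : Matrix d d ℂ))

/-- The set `e^𝔤` of exponentials of elements of the dynamical Lie algebra. -/
def expSet (H : Fin K → selfAdjoint (Matrix d d ℂ)) : Set (Matrix.unitaryGroup d ℂ) :=
  {U | ∃ X ∈ dynLie H, (U : Matrix d d ℂ) = NormedSpace.exp X}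

/-- The compact group `G` of the circuit: the closed subgroup of `U(d)` generated by `e^𝔤`. It is
`e^𝔤` itself when `e^𝔤` is a compact group, see `dynGroup_eq`. -/
def dynGroup (H : Fin K → selfAdjoint (Matrix d d ℂ)) : Subgroup (Matrix.unitaryGroup d ℂ) :=
  (Subgroup.closure (expSet H)).topologicalClosure

theorem dynGroup_eq (H : Fin K → selfAdjoint (Matrix d d ℂ))
    (G : Subgroup (Matrix.unitaryGroup d ℂ)) (hG : (G : Set (Matrix.unitaryGroup d ℂ)) = expSet H)
    (hc : IsCompact (G : Set (Matrix.unitaryGroup d ℂ))) : dynGroup H = G := by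
  rw [dynGroup, ← hG, Subgroup.closure_eq]
  exact le_antisymm (Subgroup.topologicalClosure_minimal _ le_rfl hc.isClosed)
    (Subgroup.le_topologicalClosure _)

instance (H : Fin K → selfAdjoint (Matrix d d ℂ)) : CompactSpace (dynGroup H) :=
  isCompact_iff_compactSpace.mp (Subgroup.isClosed_topologicalClosure _).isCompact

/-- The law of the Haar ensemble over `G`: the normalized Haar measure of `G`, as a measure on
`U(d)`. -/
def haarEnsemble (H : Fin K → selfAdjoint (Matrix d d ℂ)) : Measure (Matrix.unitaryGroup d ℂ) :=
  (Measure.haarMeasure (⊤ : TopologicalSpace.PositiveCompacts (dynGroup H))).map Subtype.val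

instance (H : Fin K → selfAdjoint (Matrix d d ℂ)) : IsFiniteMeasure (haarEnsemble H) := by
  unfold haarEnsemble; infer_instance

/-- The expressiveness superoperator `A^{(t)}_E = M^{(t)}_E - M^{(t)}_G` of an ensemble `E` with
law `μ`. -/
def expressiveness (H : Fin K → selfAdjoint (Matrix d d ℂ)) (t : ℕ)
    (μ : Measure (Matrix.unitaryGroup d ℂ)) [IsFiniteMeasure μ] :
    Module.End ℂ (Matrix (Fin t → d) (Fin t → d) ℂ) :=
  moment t μ - moment t (haarEnsemble H)

/-- An ensemble with law `μ` is an `ε`-approximate `G` `t`-design if `‖A^{(t)}_E‖_∞ ≤ ε`. -/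
def IsApproxDesign (H : Fin K → selfAdjoint (Matrix d d ℂ)) (t : ℕ) (ε : ℝ)
    (μ : Measure (Matrix.unitaryGroup d ℂ)) [IsFiniteMeasure μ] : Prop :=
  superNorm (expressiveness H t μ) ≤ ε

end Circuit

end

end PQC

/-!
Write `U · A` for `U^{⊗t} A (U†)^{⊗t}`, `M` for the moment operator of a single layer and `P` for
that of the Haar ensemble, on the Hilbert space of matrices with the Hilbert–Schmidt inner product.

Left invariance of the Haar measure and unitarity of the action make `P` the orthogonal projection
onto the `G`-invariant matrices (`conjTensor_moment_haarEnsemble`, `inner_moment_haarEnsemble`).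
Since layers take values in `G`, also `M P = P M = P`; here `P M = P` follows from orthogonality, so
right invariance of the Haar measure plays no role. By independence of the layers, the moment
operator of `L` layers is `M ^ L` (`moment_ensemble_succ`), whence `M ^ L - P = (M - P) ^ L`
(`expressiveness_ensemble_eq_pow`). The bounds for `L` layers then only use that an induced norm is
an operator norm (`inducedNorm_eq_norm_conjCLM`), hence submultiplicative, and that
`‖T ^ L‖ = ‖T‖ ^ L` for self-adjoint `T`.

The heart of the matter is `‖M - P‖ < 1` (`superNorm_expressiveness_lt_one`). The norm is attained,
at `X` say. Put `A = X - P X`, so that `(M - P) X = M A` and `‖A‖ ≤ ‖X‖`. If the norm were at least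
`1`, then `‖M A‖ ≥ ‖A‖`, and as the variance of `U · A` is `‖A‖² - ‖M A‖²`, the matrix `U · A` would
be equal to `M A` for all `U` in the support of the layer ensemble
(`conjTensor_eq_moment_of_norm_le`). The condition `U₁(θ) · A = M A` is real analytic in `θ` and
holds on a set of positive Lebesgue measure, hence for all `θ`
(`eq_zero_of_analytic_of_volume_pos`). Taking `θ = 0` and differentiating along the coordinate axes
shows that the generators `i Hₖ`, acting on `(ℂ^d)^{⊗t}` as derivations, commute with `A`
(`eq_and_commute_of_volume_pos`). Then so do the Lie algebra `𝔤`, its exponentials, and `G`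
(`conjTensor_eq_self_of_commute`). So `A = P A = P X - P² X = 0`, which contradicts
`‖X‖ ≤ ‖M A‖` and `X ≠ 0`.
-/

namespace PQC

/-! ### Zero sets of real analytic functions -/

/-- A real analytic function of one variable with a non-null zero set vanishes identically, since
otherwise its zeros are isolated, hence countable. -/
theorem eq_zero_of_analytic_of_volume_ne_zero {E : Type*} [NormedAddCommGroup E] [NormedSpace ℝ E]
    {f : ℝ → E} (hf : AnalyticOnNhd ℝ f Set.univ) {T : Set ℝ} (hT : volume T ≠ 0)
    (hfT : ∀ x ∈ T, f x = 0) (x : ℝ) : f x = 0 := by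
  rcases hf.eqOn_zero_or_eventually_ne_zero_of_preconnected isPreconnected_univ with h | h
  · exact h (Set.mem_univ x)
  · have hd := isDiscrete_of_codiscreteWithin (U := Set.univ)
      (s := {x | f x = 0}) (by simpa [Set.compl_def, Filter.Eventually] using h)
    have hc : (Set.univ ∩ {x | f x = 0} : Set ℝ).Countable :=
      (HereditarilyLindelofSpace.isLindelof _).countable_of_isDiscrete (by simpa using hd)
    have hTc : T.Countable := hc.mono fun y hy => Set.mem_inter trivial (hfT y hy)
    exact absurd (hTc.measure_zero _) hT

/-- A real analytic function on `ℝ^n` whose zero set has positive Lebesgue measure vanishes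
identically. By Fubini, non-null many slices of the zero set are non-null, and the statement reduces
to fewer variables. -/
theorem eq_zero_of_analytic_of_volume_pos {E : Type*} [NormedAddCommGroup E] [NormedSpace ℝ E]
    {n : ℕ} {f : (Fin n → ℝ) → E} (hf : AnalyticOnNhd ℝ f Set.univ)
    (hpos : 0 < volume {x | f x = 0}) (x : Fin n → ℝ) : f x = 0 := by
  induction n with
  | zero =>
    obtain ⟨y, hy⟩ := nonempty_of_measure_ne_zero hpos.ne'
    rwa [Subsingleton.elim x y]
  | succ n ih =>
    have hfc : Continuous f := continuousOn_univ.mp hf.continuousOn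
    let e := (MeasurableEquiv.piFinSuccAbove (fun _ : Fin (n + 1) => ℝ) 0).symm
    have he : ∀ p, e p = Fin.cons p.1 p.2 := fun p => by
      simp [e, MeasurableEquiv.piFinSuccAbove, Fin.insertNthEquiv]
    have hmp : MeasurePreserving e := (volume_preserving_piFinSuccAbove (fun _ => ℝ) 0).symm _
    have hS : MeasurableSet {x | f x = 0} := (isClosed_eq hfc continuous_const).measurableSet
    rw [← hmp.measure_preimage hS.nullMeasurableSet] at hpos
    -- non-null many values of the first variable have a non-null slice
    have hT : volume {a : ℝ | volume (Prod.mk a ⁻¹' (e ⁻¹' {x | f x = 0})) ≠ 0} ≠ 0 := by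
      intro h0
      exact hpos.ne' ((Measure.measure_prod_null (hmp.measurable hS)).mpr h0)
    have hcons : AnalyticOnNhd ℝ (fun p : ℝ × (Fin n → ℝ) => (Fin.cons p.1 p.2 : Fin (n + 1) → ℝ))
        Set.univ := by
      intro p _
      refine AnalyticAt.pi fun i => ?_
      refine Fin.cases ?_ (fun j => ?_) i
      · simpa using analyticAt_fst
      · simpa [Function.comp_def] using
          ((ContinuousLinearMap.proj (R := ℝ) (φ := fun _ : Fin n => ℝ) j).analyticAt p.2).comp
            analyticAt_snd
    have hzero : ∀ a ∈ {a : ℝ | volume (Prod.mk a ⁻¹' (e ⁻¹' {x | f x = 0})) ≠ 0},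
        ∀ y : Fin n → ℝ, f (Fin.cons a y) = 0 := by
      intro a ha
      refine ih (f := fun y => f (Fin.cons a y)) (fun y _ => ?_) ?_
      · exact (hf _ trivial).comp ((hcons (a, y) trivial).comp
          (f := fun y => (a, y)) (analyticAt_const.prod analyticAt_id))
      · simpa [pos_iff_ne_zero, Set.preimage, he] using ha
    have := eq_zero_of_analytic_of_volume_ne_zero (f := fun a => f (Fin.cons a (Fin.tail x)))
      (fun a _ => (hf _ trivial).comp ((hcons (a, Fin.tail x) trivial).comp
          (f := fun a => (a, Fin.tail x)) (analyticAt_id.prod analyticAt_const)))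
      hT (fun a ha => hzero a ha _) (x 0)
    simpa using this

/-! ### Induced norms as operator norms -/

section InducedNorm

variable {m : Type*} {V : Type*} [NormedAddCommGroup V] [NormedSpace ℂ V] [FiniteDimensional ℂ V]

/-- The superoperator `Φ` transported along a linear identification of the matrices with a normed
space, as a bounded operator of that space. -/
noncomputable def conjCLM (e : Matrix m m ℂ ≃ₗ[ℂ] V) (Φ : Module.End ℂ (Matrix m m ℂ)) :
    V →L[ℂ] V :=
  LinearMap.toContinuousLinearMap (e.conj Φ)

theorem conjCLM_apply (e : Matrix m m ℂ ≃ₗ[ℂ] V) (Φ : Module.End ℂ (Matrix m m ℂ))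
    (A : Matrix m m ℂ) : conjCLM e Φ (e A) = e (Φ A) := by
  simp [conjCLM, LinearEquiv.conj_apply]

theorem conjCLM_pow (e : Matrix m m ℂ ≃ₗ[ℂ] V) (Φ : Module.End ℂ (Matrix m m ℂ)) (L : ℕ) :
    conjCLM e (Φ ^ L) = conjCLM e Φ ^ L := by
  induction L with
  | zero => ext v; simp [conjCLM, LinearEquiv.conj_apply]
  | succ L ih =>
    ext v
    obtain ⟨A, rfl⟩ := e.surjective v
    rw [pow_succ', pow_succ', ← ih, mul_apply_eq_comp, conjCLM_apply, conjCLM_apply,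
      conjCLM_apply, Module.End.mul_apply]

theorem inducedNorm_eq_norm_conjCLM [Nonempty m] {N : Matrix m m ℂ → ℝ} (e : Matrix m m ℂ ≃ₗ[ℂ] V)
    (hN : ∀ A, N A = ‖e A‖) (Φ : Module.End ℂ (Matrix m m ℂ)) :
    inducedNorm N Φ = ‖conjCLM e Φ‖ := by
  have hle : ∀ r ∈ {r | ∃ A, A ≠ 0 ∧ r = N (Φ A) / N A}, r ≤ ‖conjCLM e Φ‖ := by
    rintro r ⟨A, hA, rfl⟩
    rw [hN, hN, ← conjCLM_apply]
    exact (conjCLM e Φ).ratio_le_opNorm _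
  obtain ⟨B, hB⟩ := exists_ne (0 : Matrix m m ℂ)
  refine le_antisymm (csSup_le ⟨_, B, hB, rfl⟩ hle) ?_
  refine ContinuousLinearMap.opNorm_le_bound' _ ?_ fun v hv => ?_
  · exact Real.sSup_nonneg (by rintro r ⟨A, -, rfl⟩; rw [hN, hN]; positivity)
  · obtain ⟨A, rfl⟩ := e.surjective v
    rw [conjCLM_apply, ← div_le_iff₀ (lt_of_le_of_ne (norm_nonneg _) hv.symm), ← hN, ← hN]
    exact le_csSup ⟨_, hle⟩ ⟨A, by rintro rfl; simp at hv, rfl⟩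

theorem inducedNorm_nonneg_of_norm [Nonempty m] {N : Matrix m m ℂ → ℝ} (e : Matrix m m ℂ ≃ₗ[ℂ] V)
    (hN : ∀ A, N A = ‖e A‖) (Φ : Module.End ℂ (Matrix m m ℂ)) : 0 ≤ inducedNorm N Φ := by
  rw [inducedNorm_eq_norm_conjCLM e hN]
  positivity

theorem inducedNorm_pow_le [Nonempty m] {N : Matrix m m ℂ → ℝ} (e : Matrix m m ℂ ≃ₗ[ℂ] V)
    (hN : ∀ A, N A = ‖e A‖) (Φ : Module.End ℂ (Matrix m m ℂ)) {L : ℕ} (hL : 1 ≤ L) :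
    inducedNorm N (Φ ^ L) ≤ inducedNorm N Φ ^ L := by
  rw [inducedNorm_eq_norm_conjCLM e hN, inducedNorm_eq_norm_conjCLM e hN, conjCLM_pow]
  exact norm_pow_le' _ hL

end InducedNorm

/-- In a C⋆-algebra, `‖a ^ L‖ = ‖a‖ ^ L` for self-adjoint `a`; for general `L` this follows from
the case of a power of two above `L`. -/
theorem norm_pow_of_isSelfAdjoint {A : Type*} [NormedRing A] [StarRing A] [CStarRing A] {a : A}
    (ha : IsSelfAdjoint a) {L : ℕ} (hL : 1 ≤ L) : ‖a ^ L‖ = ‖a‖ ^ L := by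
  refine le_antisymm (norm_pow_le' a hL) ?_
  rcases (norm_nonneg a).eq_or_lt with h0 | h0
  · simp [← h0, Nat.one_le_iff_ne_zero.mp hL]
  have h1 : L < 2 ^ L := Nat.lt_two_pow_self
  have h2 : ‖a‖ ^ L * ‖a‖ ^ (2 ^ L - L) ≤ ‖a ^ L‖ * ‖a‖ ^ (2 ^ L - L) :=
    calc ‖a‖ ^ L * ‖a‖ ^ (2 ^ L - L) = ‖a ^ L * a ^ (2 ^ L - L)‖ := by
          rw [← pow_add, ← pow_add, Nat.add_sub_cancel' h1.le, ha.norm_pow_two_pow]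
      _ ≤ ‖a ^ L‖ * ‖a ^ (2 ^ L - L)‖ := norm_mul_le _ _
      _ ≤ ‖a ^ L‖ * ‖a‖ ^ (2 ^ L - L) := by
          gcongr
          exact norm_pow_le' a (by omega)
  exact le_of_mul_le_mul_right h2 (by positivity)

/-- If `0 ≤ s < 1`, then `s ^ L ≤ ε` as soon as `L ≥ log (1 / ε) / log (1 / s)`. For `s = 0` the
quotient is `0` by the conventions of `Real.log` and `/`, and `0 ^ L = 0` because `1 ≤ L`. -/
theorem pow_le_of_log_div_log_le {s ε : ℝ} (hs : 0 ≤ s) (hs1 : s < 1) (hε : 0 < ε) {L : ℕ}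
    (hL : 1 ≤ L) (h : Real.log (1 / ε) / Real.log (1 / s) ≤ L) : s ^ L ≤ ε := by
  rcases hs.eq_or_lt with rfl | hs0
  · simpa [Nat.one_le_iff_ne_zero.mp hL] using hε.le
  have hlog : 0 < Real.log (1 / s) := Real.log_pos (by rwa [lt_div_iff₀ hs0, one_mul])
  rw [div_le_iff₀ hlog] at h
  rw [← Real.log_le_log_iff (by positivity) hε, Real.log_pow]
  simp only [one_div, Real.log_inv] at h
  linarith

/-! ### Tensor powers and the derivation they induce on the Lie algebra -/

section TensorPower

variable {d : Type*} [Fintype d] [DecidableEq d] {t : ℕ}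

/-- The tensor product `X₁ ⊗ ⋯ ⊗ X_t` of a family of matrices, as a homomorphism of monoids. -/
def tensorHom (d : Type*) [Fintype d] [DecidableEq d] (t : ℕ) :
    (Fin t → Matrix d d ℂ) →* Matrix (Fin t → d) (Fin t → d) ℂ where
  toFun X := Matrix.of fun i j => ∏ s, X s (i s) (j s)
  map_one' := by
    ext i j
    simp only [Matrix.of_apply, Pi.one_apply, Matrix.one_apply, funext_iff]
    rw [Finset.prod_ite_zero]
    simp
  map_mul' X Y := by
    ext i j
    simp only [Matrix.of_apply, Pi.mul_apply, Matrix.mul_apply, Finset.prod_univ_sum,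
      Fintype.piFinset_univ, Finset.prod_mul_distrib]

theorem tensorPow_eq_tensorHom (U : Matrix d d ℂ) : tensorPow t U = tensorHom d t fun _ => U := rfl

theorem tensorPow_one : tensorPow t (1 : Matrix d d ℂ) = 1 := (tensorHom d t).map_one

theorem tensorPow_mul (U V : Matrix d d ℂ) :
    tensorPow t (U * V) = tensorPow t U * tensorPow t V :=
  (tensorHom d t).map_mul (fun _ => U) fun _ => V

theorem tensorPow_star {d : Type*} (U : Matrix d d ℂ) :
    tensorPow t (star U) = (tensorPow t U).conjTranspose := by
  ext i j
  simp [tensorPow, Matrix.star_apply, Matrix.conjTranspose_apply]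

theorem tensorHom_mulSingle_apply (s : Fin t) (X : Matrix d d ℂ) (i j : Fin t → d) :
    tensorHom d t (Pi.mulSingle s X) i j =
      X (i s) (j s) * ∏ r ∈ Finset.univ.erase s, (1 : Matrix d d ℂ) (i r) (j r) := by
  change ∏ r, (Pi.mulSingle s X : Fin t → Matrix d d ℂ) r (i r) (j r) = _
  rw [← Finset.mul_prod_erase _ _ (Finset.mem_univ s), Pi.mulSingle_eq_same]
  congr 1
  refine Finset.prod_congr rfl fun r hr => ?_
  rw [Pi.mulSingle_eq_of_ne (Finset.ne_of_mem_erase hr)]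

/-- The algebra homomorphism `X ↦ 1 ⊗ ⋯ ⊗ X ⊗ ⋯ ⊗ 1` with `X` acting on the tensor factor `s`. -/
def factorHom (s : Fin t) : Matrix d d ℂ →ₐ[ℂ] Matrix (Fin t → d) (Fin t → d) ℂ :=
  AlgHom.ofLinearMap
    { toFun := fun X => tensorHom d t (Pi.mulSingle s X)
      map_add' := fun X Y => by
        ext i j
        simp only [tensorHom_mulSingle_apply, Matrix.add_apply, add_mul]
      map_smul' := fun c X => by
        ext i j
        simp only [tensorHom_mulSingle_apply, Matrix.smul_apply, smul_eq_mul, mul_assoc,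
          RingHom.id_apply] }
    (by simp)
    (fun X Y => by
      change tensorHom d t _ = tensorHom d t _ * tensorHom d t _
      rw [Pi.mulSingle_mul, map_mul])

theorem factorHom_apply (s : Fin t) (X : Matrix d d ℂ) :
    factorHom s X = tensorHom d t (Pi.mulSingle s X) := rfl

theorem commute_factorHom {s r : Fin t} (h : s ≠ r) (X Y : Matrix d d ℂ) :
    Commute (factorHom s X) (factorHom r Y) := by
  have hc : Commute (Pi.mulSingle s X : Fin t → Matrix d d ℂ) (Pi.mulSingle r Y) :=
    Pi.mulSingle_commute (f := fun _ : Fin t => Matrix d d ℂ) h X Y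
  rw [factorHom_apply, factorHom_apply, commute_iff_eq, ← map_mul, ← map_mul, hc.eq]

/-- The differential `X ↦ ∑ₛ 1 ⊗ ⋯ ⊗ X ⊗ ⋯ ⊗ 1` of `U ↦ U^{⊗t}` at the identity. -/
def tensorDeriv (t : ℕ) : Matrix d d ℂ →ₗ[ℂ] Matrix (Fin t → d) (Fin t → d) ℂ :=
  ∑ s : Fin t, (factorHom s).toLinearMap

theorem tensorDeriv_apply (X : Matrix d d ℂ) : tensorDeriv t X = ∑ s : Fin t, factorHom s X := by
  simp [tensorDeriv]

theorem tensorDeriv_commutator (X Y : Matrix d d ℂ) :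
    tensorDeriv t (X * Y - Y * X) =
      tensorDeriv t X * tensorDeriv t Y - tensorDeriv t Y * tensorDeriv t X := by
  simp only [tensorDeriv_apply, Finset.sum_mul_sum]
  conv_rhs => rw [Finset.sum_comm (f := fun s r : Fin t => factorHom s Y * factorHom r X)]
  rw [← Finset.sum_sub_distrib]
  refine Finset.sum_congr rfl fun s _ => ?_
  rw [← Finset.sum_sub_distrib, Finset.sum_eq_single s]
  · simp
  · exact fun r _ h => sub_eq_zero.mpr (commute_factorHom h.symm X Y)
  · simp

theorem exp_tensorDeriv (X : Matrix d d ℂ) :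
    NormedSpace.exp (tensorDeriv t X) = tensorPow t (NormedSpace.exp X) := by
  have hf : ∀ s : Fin t, NormedSpace.exp (factorHom s X) = factorHom s (NormedSpace.exp X) := by
    intro s
    have hc : Continuous (factorHom (d := d) s) :=
      (factorHom (d := d) s).toLinearMap.continuous_of_finiteDimensional
    open scoped Matrix.Norms.Operator in
    exact (NormedSpace.map_exp (factorHom s) hc X).symm
  have hpw : ((Finset.univ : Finset (Fin t)) : Set (Fin t)).Pairwise
      (Function.onFun Commute fun s => factorHom s X) := fun s _ r _ h => commute_factorHom h X X
  have hprod := Finset.map_noncommProd (g := tensorHom d t) Finset.univ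
    (fun s => (Pi.mulSingle s (NormedSpace.exp X) : Fin t → Matrix d d ℂ))
    fun s _ r _ h => Pi.mulSingle_commute (f := fun _ : Fin t => Matrix d d ℂ) h _ _
  rw [Finset.noncommProd_mulSingle (M := fun _ : Fin t => Matrix d d ℂ)
    fun _ : Fin t => NormedSpace.exp X] at hprod
  rw [tensorDeriv_apply, Matrix.exp_sum_of_commute _ _ hpw, tensorPow_eq_tensorHom, hprod]
  exact Finset.noncommProd_congr rfl (fun s _ => hf s) _

end TensorPower

/-! ### Products of one-parameter groups -/

section OneParameter

/-- An element that commutes with a one-parameter group commutes with its generator. -/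
theorem commute_of_forall_commute_exp_smul {R : Type*} [NormedRing R] [NormedAlgebra ℝ R]
    [CompleteSpace R] {D A : R} (h : ∀ r : ℝ, Commute (NormedSpace.exp (r • D)) A) :
    Commute D A := by
  have h1 := hasDerivAt_exp_smul_const (𝕂 := ℝ) D 0
  rw [zero_smul, NormedSpace.exp_zero, one_mul] at h1
  have h2 := h1.mul_const A
  rw [show (fun r : ℝ => NormedSpace.exp (r • D) * A) = fun r => A * NormedSpace.exp (r • D) from
    funext fun r => h r] at h2
  exact h2.unique (h1.const_mul A)

theorem commute_matrix_of_forall_commute_exp_smul {m : Type*} [Fintype m] [DecidableEq m]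
    {D A : Matrix m m ℂ} (h : ∀ r : ℝ, Commute (NormedSpace.exp (r • D)) A) : Commute D A :=
  open scoped Matrix.Norms.Operator in commute_of_forall_commute_exp_smul h

theorem commute_exp_matrix {m : Type*} [Fintype m] [DecidableEq m]
    {D A : Matrix m m ℂ} (h : Commute D A) : Commute (NormedSpace.exp D) A :=
  open scoped Matrix.Norms.Operator in h.exp_left

theorem analyticOnNhd_prod_exp {R : Type*} [NormedRing R] [NormedAlgebra ℝ R]
    [CompleteSpace R] {K : ℕ} (D : Fin K → R) :
    AnalyticOnNhd ℝ (fun θ : Fin K → ℝ =>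
      (List.ofFn fun k => NormedSpace.exp (θ k • D k)).prod) Set.univ := by
  induction K with
  | zero => exact fun θ _ => by simpa using analyticAt_const
  | succ K ih =>
    intro θ _
    have htail : AnalyticAt ℝ (fun θ : Fin (K + 1) → ℝ => fun k : Fin K => θ k.succ) θ :=
      AnalyticAt.pi fun k =>
        (ContinuousLinearMap.proj (R := ℝ) (φ := fun _ : Fin (K + 1) => ℝ) k.succ).analyticAt θ
    have hhead : AnalyticAt ℝ (fun θ : Fin (K + 1) → ℝ => θ 0 • D 0) θ :=
      ((ContinuousLinearMap.proj (R := ℝ) (φ := fun _ : Fin (K + 1) => ℝ) 0).analyticAt θ).smul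
        analyticAt_const
    simp only [List.ofFn_succ, List.prod_cons]
    exact ((NormedSpace.exp_analytic (𝕂 := ℝ) _).comp hhead).mul
      ((ih (fun k => D k.succ) _ trivial).comp htail)

/-- The parameters `θ` for which `exp (θ₁ D₁) ⋯ exp (θ_K D_K)` intertwines `A` and `B` form an
analytic set. Hence if they do not form a null set, they are all of `ℝ^K`. -/
theorem intertwines_prod_exp_of_volume_pos {R : Type*} [NormedRing R] [NormedAlgebra ℝ R]
    [CompleteSpace R] {K : ℕ} (D : Fin K → R) (A B : R)
    (h : 0 < volume {θ : Fin K → ℝ | (List.ofFn fun k => NormedSpace.exp (θ k • D k)).prod * A =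
      B * (List.ofFn fun k => NormedSpace.exp (θ k • D k)).prod}) (θ : Fin K → ℝ) :
    (List.ofFn fun k => NormedSpace.exp (θ k • D k)).prod * A =
      B * (List.ofFn fun k => NormedSpace.exp (θ k • D k)).prod := by
  have ha := analyticOnNhd_prod_exp D
  refine sub_eq_zero.mp (eq_zero_of_analytic_of_volume_pos (f := fun θ : Fin K → ℝ =>
    (List.ofFn fun k => NormedSpace.exp (θ k • D k)).prod * A -
      B * (List.ofFn fun k => NormedSpace.exp (θ k • D k)).prod)
    (fun θ hθ => ((ha θ hθ).mul analyticAt_const).sub (analyticAt_const.mul (ha θ hθ))) ?_ θ)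
  simpa only [sub_eq_zero] using h

theorem intertwines_prod_exp_matrix_of_volume_pos {m : Type*} [Fintype m] [DecidableEq m] {K : ℕ}
    (D : Fin K → Matrix m m ℂ) (A B : Matrix m m ℂ)
    (h : 0 < volume {θ : Fin K → ℝ | (List.ofFn fun k => NormedSpace.exp (θ k • D k)).prod * A =
      B * (List.ofFn fun k => NormedSpace.exp (θ k • D k)).prod}) (θ : Fin K → ℝ) :
    (List.ofFn fun k => NormedSpace.exp (θ k • D k)).prod * A =
      B * (List.ofFn fun k => NormedSpace.exp (θ k • D k)).prod :=
  open scoped Matrix.Norms.Operator in intertwines_prod_exp_of_volume_pos D A B h θ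

theorem prod_ofFn_eq_of_forall_ne {M : Type*} [Monoid M] {n : ℕ} {f : Fin n → M} (k : Fin n)
    (h : ∀ j, j ≠ k → f j = 1) : (List.ofFn f).prod = f k := by
  induction n with
  | zero => exact k.elim0
  | succ n ih =>
    rw [List.ofFn_succ, List.prod_cons]
    induction k using Fin.cases with
    | zero =>
      have : (fun i : Fin n => f i.succ) = fun _ => 1 := funext fun i => h _ (Fin.succ_ne_zero i)
      simp [this, List.ofFn_const]
    | succ k =>
      rw [h 0 (Fin.succ_ne_zero k).symm, one_mul]
      exact ih (f := fun i => f i.succ) k fun j hj => h _ (by simpa using hj)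

/-- If the products `exp (θ₁ D₁) ⋯ exp (θ_K D_K)` intertwine `A` and `B` for non-null many `θ`,
then `A = B` and every generator `D_k` commutes with `A`. -/
theorem eq_and_commute_of_volume_pos {m : Type*} [Fintype m] [DecidableEq m] {K : ℕ}
    (D : Fin K → Matrix m m ℂ) (A B : Matrix m m ℂ)
    (h : 0 < volume {θ : Fin K → ℝ | (List.ofFn fun k => NormedSpace.exp (θ k • D k)).prod * A =
      B * (List.ofFn fun k => NormedSpace.exp (θ k • D k)).prod}) :
    A = B ∧ ∀ k, Commute (D k) A := by
  have hall := intertwines_prod_exp_matrix_of_volume_pos D A B h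
  have hAB : A = B := by
    have h0 := hall 0
    simpa [List.ofFn_const] using h0
  refine ⟨hAB, fun k => commute_matrix_of_forall_commute_exp_smul fun r => ?_⟩
  have hk := hall (Pi.single k r)
  rw [prod_ofFn_eq_of_forall_ne k fun j hj => by simp [hj], Pi.single_eq_same, ← hAB] at hk
  exact hk

end OneParameter

/-! ### The Hilbert–Schmidt space and the conjugation action -/

section HilbertSchmidt

variable {m : Type*}

/-- The matrices as the Hilbert space of their entries, with the Hilbert–Schmidt inner product. -/
noncomputable def hsEquiv (m : Type*) : Matrix m m ℂ ≃ₗ[ℂ] EuclideanSpace ℂ (m × m) :=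
  (Matrix.ofLinearEquiv ℂ).symm ≪≫ₗ (LinearEquiv.curry ℂ ℂ m m).symm ≪≫ₗ
    (WithLp.linearEquiv 2 ℂ (m × m → ℂ)).symm

theorem hsEquiv_apply (A : Matrix m m ℂ) (p : m × m) : hsEquiv m A p = A p.1 p.2 := rfl

variable [Fintype m]

theorem hsNorm_eq_norm_hsEquiv (A : Matrix m m ℂ) : hsNorm A = ‖hsEquiv m A‖ := by
  rw [hsNorm, EuclideanSpace.norm_eq, Fintype.sum_prod_type]
  rfl

theorem inner_hsEquiv (A B : Matrix m m ℂ) :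
    inner ℂ (hsEquiv m A) (hsEquiv m B) = (A.conjTranspose * B).trace := by
  rw [PiLp.inner_apply, Fintype.sum_prod_type, Finset.sum_comm]
  simp [Matrix.trace, Matrix.mul_apply, hsEquiv_apply, mul_comm]

end HilbertSchmidt

section Conjugation

variable {d : Type*} [Fintype d] [DecidableEq d] {t : ℕ}

theorem conjTensor_one (A : Matrix (Fin t → d) (Fin t → d) ℂ) : conjTensor t 1 A = A := by
  simp [conjTensor, tensorPow_one]

theorem conjTensor_mul (U V : Matrix.unitaryGroup d ℂ) (A : Matrix (Fin t → d) (Fin t → d) ℂ) :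
    conjTensor t (U * V) A = conjTensor t U (conjTensor t V A) := by
  simp [conjTensor, tensorPow_mul, star_mul, mul_assoc]

theorem tensorPow_star_mul_self (U : Matrix.unitaryGroup d ℂ) :
    tensorPow t (star (U : Matrix d d ℂ)) * tensorPow t (U : Matrix d d ℂ) = 1 := by
  rw [← tensorPow_mul, Matrix.UnitaryGroup.star_mul_self, tensorPow_one]

theorem conjTensor_eq_iff (U : Matrix.unitaryGroup d ℂ)
    (A B : Matrix (Fin t → d) (Fin t → d) ℂ) :
    conjTensor t U A = B ↔
      tensorPow t (U : Matrix d d ℂ) * A = B * tensorPow t (U : Matrix d d ℂ) := by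
  have h1 := tensorPow_star_mul_self (t := t) U
  have h2 := mul_eq_one_comm.mp h1
  constructor
  · rintro rfl
    rw [conjTensor, mul_assoc _ _ (tensorPow t (U : Matrix d d ℂ)), h1, mul_one]
  · intro h
    rw [conjTensor, h, mul_assoc, h2, mul_one]

theorem inner_conjTensor (U : Matrix.unitaryGroup d ℂ)
    (A B : Matrix (Fin t → d) (Fin t → d) ℂ) :
    inner ℂ (hsEquiv _ (conjTensor t U A)) (hsEquiv _ (conjTensor t U B)) =
      inner ℂ (hsEquiv _ A) (hsEquiv _ B) := by
  have h1 := tensorPow_star_mul_self (t := t) U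
  rw [inner_hsEquiv, inner_hsEquiv, conjTensor, conjTensor, tensorPow_star] at *
  simp only [Matrix.conjTranspose_mul, Matrix.conjTranspose_conjTranspose]
  rw [Matrix.trace_mul_comm]
  simp only [mul_assoc]
  rw [← mul_assoc (Matrix.conjTranspose (tensorPow t (U : Matrix d d ℂ))), h1, one_mul,
    Matrix.trace_mul_comm]
  simp only [mul_assoc]
  rw [h1, mul_one, Matrix.trace_mul_comm]

theorem norm_conjTensor (U : Matrix.unitaryGroup d ℂ) (A : Matrix (Fin t → d) (Fin t → d) ℂ) :
    ‖hsEquiv _ (conjTensor t U A)‖ = ‖hsEquiv _ A‖ := by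
  rw [@norm_eq_sqrt_re_inner ℂ, inner_conjTensor, ← @norm_eq_sqrt_re_inner ℂ]

/-- Conjugation by `U^{⊗t}` as a superoperator. -/
noncomputable def conjEnd (t : ℕ) (U : Matrix.unitaryGroup d ℂ) :
    Module.End ℂ (Matrix (Fin t → d) (Fin t → d) ℂ) where
  toFun := conjTensor t U
  map_add' A B := by simp [conjTensor, Matrix.mul_add, Matrix.add_mul]
  map_smul' c A := by simp [conjTensor]

theorem continuous_hsEquiv_conjTensor (A : Matrix (Fin t → d) (Fin t → d) ℂ) :
    Continuous fun U : Matrix.unitaryGroup d ℂ => hsEquiv _ (conjTensor t U A) :=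
  (PiLp.continuous_toLp 2 _).comp <|
    continuous_pi fun p => continuous_conjTensor_apply t A p.1 p.2

theorem integrable_hsEquiv_conjTensor (μ : Measure (Matrix.unitaryGroup d ℂ))
    [IsFiniteMeasure μ] (A : Matrix (Fin t → d) (Fin t → d) ℂ) :
    Integrable (fun U : Matrix.unitaryGroup d ℂ => hsEquiv _ (conjTensor t U A)) μ :=
  (continuous_hsEquiv_conjTensor A).integrable_of_hasCompactSupport
    (HasCompactSupport.of_compactSpace _)

/-- The entrywise integral that defines the moment operator is a Bochner integral in the
Hilbert–Schmidt space. -/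
theorem hsEquiv_moment (μ : Measure (Matrix.unitaryGroup d ℂ)) [IsFiniteMeasure μ]
    (A : Matrix (Fin t → d) (Fin t → d) ℂ) :
    hsEquiv _ (moment t μ A) = ∫ U, hsEquiv _ (conjTensor t U A) ∂μ := by
  ext p
  exact ((EuclideanSpace.proj (𝕜 := ℂ) p).integral_comp_comm
    (integrable_hsEquiv_conjTensor μ A))

theorem inner_moment (μ : Measure (Matrix.unitaryGroup d ℂ)) [IsFiniteMeasure μ]
    (W A : Matrix (Fin t → d) (Fin t → d) ℂ) :
    inner ℂ (hsEquiv _ W) (hsEquiv _ (moment t μ A)) =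
      ∫ U, inner ℂ (hsEquiv _ W) (hsEquiv _ (conjTensor t U A)) ∂μ := by
  rw [hsEquiv_moment, integral_inner (integrable_hsEquiv_conjTensor μ A)]

theorem moment_eq_self {μ : Measure (Matrix.unitaryGroup d ℂ)} [IsProbabilityMeasure μ]
    {W : Matrix (Fin t → d) (Fin t → d) ℂ} (hW : ∀ᵐ U ∂μ, conjTensor t U W = W) :
    moment t μ W = W := by
  apply (hsEquiv _).injective
  rw [hsEquiv_moment, integral_congr_ae (hW.mono fun U hU => congrArg (hsEquiv _) hU)]
  simp

theorem inner_moment_of_invariant {μ : Measure (Matrix.unitaryGroup d ℂ)} [IsProbabilityMeasure μ]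
    {W : Matrix (Fin t → d) (Fin t → d) ℂ} (hW : ∀ᵐ U ∂μ, conjTensor t U W = W)
    (A : Matrix (Fin t → d) (Fin t → d) ℂ) :
    inner ℂ (hsEquiv _ W) (hsEquiv _ (moment t μ A)) = inner ℂ (hsEquiv _ W) (hsEquiv _ A) := by
  have h : ∀ᵐ U ∂μ, inner ℂ (hsEquiv _ W) (hsEquiv _ (conjTensor t U A)) =
      inner ℂ (hsEquiv _ W) (hsEquiv _ A) := by
    filter_upwards [hW] with U hU
    conv_lhs => rw [← hU]
    rw [inner_conjTensor]
  rw [inner_moment, integral_congr_ae h]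
  simp

/-- The variance of the random matrix `U^{⊗t} A (U†)^{⊗t}` in the Hilbert–Schmidt norm. -/
theorem integral_norm_conjTensor_sub_moment_sq (μ : Measure (Matrix.unitaryGroup d ℂ))
    [IsProbabilityMeasure μ] (A : Matrix (Fin t → d) (Fin t → d) ℂ) :
    ∫ U, ‖hsEquiv _ (conjTensor t U A) - hsEquiv _ (moment t μ A)‖ ^ 2 ∂μ =
      ‖hsEquiv _ A‖ ^ 2 - ‖hsEquiv _ (moment t μ A)‖ ^ 2 := by
  have hi : Integrable (fun U => inner ℂ (hsEquiv _ (moment t μ A))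
      (hsEquiv _ (conjTensor t U A))) μ :=
    (integrable_hsEquiv_conjTensor μ A).const_inner _
  have h1 : ∀ U : Matrix.unitaryGroup d ℂ,
      ‖hsEquiv _ (conjTensor t U A) - hsEquiv _ (moment t μ A)‖ ^ 2 =
        (‖hsEquiv _ A‖ ^ 2 + ‖hsEquiv _ (moment t μ A)‖ ^ 2) -
          2 * RCLike.re (inner ℂ (hsEquiv _ (moment t μ A)) (hsEquiv _ (conjTensor t U A))) := by
    intro U
    rw [@norm_sub_sq ℂ, norm_conjTensor, inner_re_symm]
    ring
  simp_rw [h1]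
  rw [integral_sub (integrable_const _) (hi.re.const_mul 2), integral_const_mul, integral_re hi,
    ← inner_moment, inner_self_eq_norm_sq]
  simp
  ring

theorem norm_moment_le (μ : Measure (Matrix.unitaryGroup d ℂ)) [IsProbabilityMeasure μ]
    (A : Matrix (Fin t → d) (Fin t → d) ℂ) : ‖hsEquiv _ (moment t μ A)‖ ≤ ‖hsEquiv _ A‖ := by
  have h := integral_norm_conjTensor_sub_moment_sq μ A
  have h0 : 0 ≤ ∫ U, ‖hsEquiv _ (conjTensor t U A) - hsEquiv _ (moment t μ A)‖ ^ 2 ∂μ :=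
    integral_nonneg fun U => by positivity
  exact le_of_sq_le_sq (by linarith) (norm_nonneg _)

/-- If averaging over `μ` does not decrease the norm of `A`, there is nothing to average:
`U^{⊗t} A (U†)^{⊗t}` is constant on the support of `μ`. -/
theorem conjTensor_eq_moment_of_norm_le {μ : Measure (Matrix.unitaryGroup d ℂ)}
    [IsProbabilityMeasure μ] {A : Matrix (Fin t → d) (Fin t → d) ℂ}
    (h : ‖hsEquiv _ A‖ ≤ ‖hsEquiv _ (moment t μ A)‖) {U : Matrix.unitaryGroup d ℂ}
    (hU : U ∈ μ.support) : conjTensor t U A = moment t μ A := by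
  have hc : Continuous fun U : Matrix.unitaryGroup d ℂ =>
      ‖hsEquiv _ (conjTensor t U A) - hsEquiv _ (moment t μ A)‖ ^ 2 :=
    ((continuous_hsEquiv_conjTensor A).sub continuous_const).norm.pow 2
  have h0 : ∫ U, ‖hsEquiv _ (conjTensor t U A) - hsEquiv _ (moment t μ A)‖ ^ 2 ∂μ = 0 := by
    rw [integral_norm_conjTensor_sub_moment_sq, (norm_moment_le μ A).antisymm h, sub_self]
  have hint : Integrable (fun U : Matrix.unitaryGroup d ℂ =>
      ‖hsEquiv _ (conjTensor t U A) - hsEquiv _ (moment t μ A)‖ ^ 2) μ :=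
    hc.integrable_of_hasCompactSupport (HasCompactSupport.of_compactSpace _)
  have hae := (integral_eq_zero_iff_of_nonneg (fun U => by positivity) hint).mp h0
  have hmem := Measure.support_subset_of_isClosed (isClosed_eq hc continuous_const) hae hU
  have h1 : ‖hsEquiv _ (conjTensor t U A) - hsEquiv _ (moment t μ A)‖ ^ 2 = 0 := hmem
  exact (hsEquiv _).injective (sub_eq_zero.mp (by simpa using h1))

end Conjugation

/-! ### The moment operator of the Haar ensemble is an orthogonal projection -/

section Haar

variable {d : Type*} [Fintype d] [DecidableEq d] {K t : ℕ}
  (H : Fin K → selfAdjoint (Matrix d d ℂ))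

instance : IsProbabilityMeasure
    (Measure.haarMeasure (⊤ : TopologicalSpace.PositiveCompacts (dynGroup H))) :=
  ⟨by simpa using Measure.haarMeasure_self
        (K₀ := (⊤ : TopologicalSpace.PositiveCompacts (dynGroup H)))⟩

instance : IsProbabilityMeasure (haarEnsemble H) :=
  Measure.isProbabilityMeasure_map measurable_subtype_coe.aemeasurable

theorem ae_mem_dynGroup_haarEnsemble : ∀ᵐ U ∂haarEnsemble H, U ∈ dynGroup H := by
  have hm : MeasurableSet {U | U ∈ dynGroup H} :=
    (Subgroup.isClosed_topologicalClosure _).measurableSet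
  rw [haarEnsemble, ae_map_iff measurable_subtype_coe.aemeasurable hm]
  exact Filter.Eventually.of_forall fun g => g.2

/-- The averages over `G` are `G`-invariant, by left invariance of the Haar measure. -/
theorem conjTensor_moment_haarEnsemble {g : Matrix.unitaryGroup d ℂ} (hg : g ∈ dynGroup H)
    (A : Matrix (Fin t → d) (Fin t → d) ℂ) :
    conjTensor t g (moment t (haarEnsemble H) A) = moment t (haarEnsemble H) A := by
  apply (hsEquiv _).injective
  have hcomm : hsEquiv _ (conjTensor t g (moment t (haarEnsemble H) A)) =
      ∫ U, hsEquiv _ (conjTensor t (g * U) A) ∂haarEnsemble H := by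
    change hsEquiv _ (conjEnd t g _) = _
    rw [← conjCLM_apply, hsEquiv_moment,
      ← (conjCLM (hsEquiv _) (conjEnd t g)).integral_comp_comm (integrable_hsEquiv_conjTensor _ A)]
    simp only [conjCLM_apply, conjTensor_mul]
    rfl
  have hc := continuous_hsEquiv_conjTensor (t := t) A
  have hgc : Continuous fun U : Matrix.unitaryGroup d ℂ => hsEquiv _ (conjTensor t (g * U) A) :=
    hc.comp (continuous_const_mul g)
  rw [hcomm, hsEquiv_moment, haarEnsemble,
    integral_map measurable_subtype_coe.aemeasurable
      hgc.aestronglyMeasurable,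
    integral_map measurable_subtype_coe.aemeasurable hc.aestronglyMeasurable]
  exact integral_mul_left_eq_self
    (fun U : dynGroup H => hsEquiv _ (conjTensor t (U : Matrix.unitaryGroup d ℂ) A)) ⟨g, hg⟩

variable {H}

/-- `moment t (haarEnsemble H) A` is the orthogonal projection of `A` to the `G`-invariant
matrices. -/
theorem inner_moment_haarEnsemble {W : Matrix (Fin t → d) (Fin t → d) ℂ}
    (hW : ∀ g ∈ dynGroup H, conjTensor t g W = W) (A : Matrix (Fin t → d) (Fin t → d) ℂ) :
    inner ℂ (hsEquiv _ W) (hsEquiv _ (moment t (haarEnsemble H) A)) =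
      inner ℂ (hsEquiv _ W) (hsEquiv _ A) :=
  inner_moment_of_invariant ((ae_mem_dynGroup_haarEnsemble H).mono fun _ hU => hW _ hU) A

theorem moment_haarEnsemble_eq_self {W : Matrix (Fin t → d) (Fin t → d) ℂ}
    (hW : ∀ g ∈ dynGroup H, conjTensor t g W = W) : moment t (haarEnsemble H) W = W :=
  moment_eq_self ((ae_mem_dynGroup_haarEnsemble H).mono fun _ hU => hW _ hU)

theorem norm_sub_moment_haarEnsemble_le (A : Matrix (Fin t → d) (Fin t → d) ℂ) :
    ‖hsEquiv _ (A - moment t (haarEnsemble H) A)‖ ≤ ‖hsEquiv _ A‖ := by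
  have h := inner_moment_haarEnsemble (t := t)
    (fun g hg => conjTensor_moment_haarEnsemble H hg A) A
  rw [inner_self_eq_norm_sq_to_K] at h
  have h2 := @norm_sub_sq ℂ _ _ _ _ (hsEquiv _ A) (hsEquiv _ (moment t (haarEnsemble H) A))
  rw [inner_re_symm, ← h] at h2
  rw [map_sub]
  refine le_of_sq_le_sq ?_ (norm_nonneg _)
  rw [h2, ← RCLike.ofReal_pow, RCLike.ofReal_re]
  nlinarith [sq_nonneg ‖hsEquiv _ (moment t (haarEnsemble H) A)‖]

theorem inner_moment_haarEnsemble_left (A B : Matrix (Fin t → d) (Fin t → d) ℂ) :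
    inner ℂ (hsEquiv _ (moment t (haarEnsemble H) A)) (hsEquiv _ B) =
      inner ℂ (hsEquiv _ A) (hsEquiv _ (moment t (haarEnsemble H) B)) := by
  rw [← inner_moment_haarEnsemble fun g hg => conjTensor_moment_haarEnsemble H hg A,
    ← inner_conj_symm, inner_moment_haarEnsemble fun g hg => conjTensor_moment_haarEnsemble H hg B,
    inner_conj_symm]

variable {μ : Measure (Matrix.unitaryGroup d ℂ)} [IsProbabilityMeasure μ]

theorem moment_mul_moment_haarEnsemble (hμ : ∀ᵐ U ∂μ, U ∈ dynGroup H) :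
    moment t μ * moment t (haarEnsemble H) = moment t (haarEnsemble H) :=
  LinearMap.ext fun A => moment_eq_self <|
    hμ.mono fun _ hU => conjTensor_moment_haarEnsemble H hU A

theorem moment_haarEnsemble_mul_moment (hμ : ∀ᵐ U ∂μ, U ∈ dynGroup H) :
    moment t (haarEnsemble H) * moment t μ = moment t (haarEnsemble H) := by
  refine LinearMap.ext fun A => ?_
  rw [Module.End.mul_apply, ← sub_eq_zero]
  obtain ⟨W, hWdef⟩ : ∃ W, W = moment t (haarEnsemble H) (moment t μ A) -
    moment t (haarEnsemble H) A := ⟨_, rfl⟩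
  -- the difference is invariant, and orthogonal to the invariant matrices
  have hW : ∀ g ∈ dynGroup H, conjTensor t g W = W := fun g hg => by
    change conjEnd t g W = W
    rw [hWdef, map_sub]
    exact congrArg₂ _ (conjTensor_moment_haarEnsemble H hg _)
      (conjTensor_moment_haarEnsemble H hg _)
  have h0 : inner ℂ (hsEquiv _ W) (hsEquiv _ (moment t (haarEnsemble H) (moment t μ A) -
      moment t (haarEnsemble H) A)) = 0 := by
    rw [map_sub, inner_sub_right, inner_moment_haarEnsemble hW, inner_moment_haarEnsemble hW,
      inner_moment_of_invariant (hμ.mono fun _ hU => hW _ hU), sub_self]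
  rw [← hWdef] at h0 ⊢
  simpa using h0

end Haar

/-! ### Layers, circuits and the dynamical group -/

section Circuit

variable {d : Type*} [Fintype d] [DecidableEq d] {K t : ℕ}
  (H : Fin K → selfAdjoint (Matrix d d ℂ))

attribute [local instance] LieRing.ofAssociativeRing

theorem gate_mem_dynGroup (k : Fin K) (r : ℝ) : gate (H k) r ∈ dynGroup H := by
  refine Subgroup.le_topologicalClosure _ (Subgroup.subset_closure ?_)
  refine ⟨(-r) • Complex.I • (H k : Matrix d d ℂ),
    (dynLie H).smul_mem _ (LieSubalgebra.subset_lieSpan ⟨k, rfl⟩), ?_⟩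
  change NormedSpace.exp _ = _
  congr 1
  ext i j
  simp
  ring

theorem layer_mem_dynGroup (θ : Fin K → ℝ) : layer H θ ∈ dynGroup H :=
  Subgroup.list_prod_mem _ fun U hU => by
    obtain ⟨k, rfl⟩ := List.mem_ofFn.mp hU
    exact gate_mem_dynGroup H k _

theorem circuit_mem_dynGroup {L : ℕ} (Θ : Fin L → Fin K → ℝ) : circuit H Θ ∈ dynGroup H :=
  Subgroup.list_prod_mem _ fun U hU => by
    obtain ⟨k, rfl⟩ := List.mem_ofFn.mp (List.mem_reverse.mp hU)
    exact layer_mem_dynGroup H _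

theorem continuous_gate (A : selfAdjoint (Matrix d d ℂ)) : Continuous (gate A) := by
  refine Continuous.subtype_mk ?_ _
  have h : Continuous (NormedSpace.exp : Matrix d d ℂ → Matrix d d ℂ) :=
    open scoped Matrix.Norms.Operator in NormedSpace.exp_continuous
  exact h.comp (by fun_prop)

theorem continuous_layer : Continuous (layer H) := by
  have h : layer H = fun θ => ((List.finRange K).map fun k => gate (H k) (θ k)).prod := by
    funext θ
    rw [layer, List.ofFn_eq_map]
  rw [h]
  exact continuous_list_prod _ fun k _ => (continuous_gate _).comp (continuous_apply k)

theorem circuit_succ {L : ℕ} (Θ : Fin (L + 1) → Fin K → ℝ) :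
    circuit H Θ = circuit H (fun l => Θ l.succ) * layer H (Θ 0) := by
  simp [circuit, List.ofFn_succ]

theorem continuous_circuit (L : ℕ) : Continuous (circuit H (L := L)) := by
  induction L with
  | zero => exact continuous_const
  | succ L ih =>
    simp_rw [funext (circuit_succ H)]
    exact (ih.comp (by fun_prop)).mul ((continuous_layer H).comp (continuous_apply 0))

variable (ν : Measure (Fin K → ℝ)) [IsProbabilityMeasure ν]

instance (L : ℕ) : IsProbabilityMeasure (ensemble H ν L) :=
  Measure.isProbabilityMeasure_map (continuous_circuit H L).measurable.aemeasurable

theorem ae_mem_dynGroup_ensemble (ν : Measure (Fin K → ℝ)) (L : ℕ) :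
    ∀ᵐ U ∂ensemble H ν L, U ∈ dynGroup H := by
  have hm : MeasurableSet {U | U ∈ dynGroup H} :=
    (Subgroup.isClosed_topologicalClosure _).measurableSet
  rw [ensemble, ae_map_iff (continuous_circuit H L).measurable.aemeasurable hm]
  exact Filter.Eventually.of_forall fun Θ => circuit_mem_dynGroup H Θ

theorem hsEquiv_moment_ensemble (L : ℕ) (A : Matrix (Fin t → d) (Fin t → d) ℂ) :
    hsEquiv _ (moment t (ensemble H ν L) A) =
      ∫ Θ, hsEquiv _ (conjTensor t (circuit H Θ) A) ∂Measure.pi fun _ : Fin L => ν := by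
  rw [hsEquiv_moment, ensemble, integral_map (continuous_circuit H L).measurable.aemeasurable
    (continuous_hsEquiv_conjTensor A).aestronglyMeasurable]

/-- Since the first layer is independent of the others, the moment operators multiply. -/
theorem hsEquiv_moment_ensemble_succ (L : ℕ) (A : Matrix (Fin t → d) (Fin t → d) ℂ) :
    hsEquiv _ (moment t (ensemble H ν (L + 1)) A) =
      ∫ θ, conjCLM (hsEquiv _) (moment t (ensemble H ν L))
        (hsEquiv _ (conjTensor t (layer H θ) A)) ∂ν := by
  let e := MeasurableEquiv.piFinSuccAbove (fun _ : Fin (L + 1) => Fin K → ℝ) 0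
  have hmp : MeasurePreserving e (Measure.pi fun _ => ν) (ν.prod (Measure.pi fun _ => ν)) :=
    measurePreserving_piFinSuccAbove (fun _ => ν) 0
  have hcont : Continuous fun p : (Fin K → ℝ) × (Fin L → Fin K → ℝ) =>
      hsEquiv _ (conjTensor t (circuit H p.2 * layer H p.1) A) :=
    (continuous_hsEquiv_conjTensor A).comp
      (((continuous_circuit H L).comp continuous_snd).mul
        ((continuous_layer H).comp continuous_fst))
  have hint : Integrable (fun p : (Fin K → ℝ) × (Fin L → Fin K → ℝ) =>
      hsEquiv _ (conjTensor t (circuit H p.2 * layer H p.1) A))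
      (ν.prod (Measure.pi fun _ => ν)) :=
    Integrable.of_bound hcont.aestronglyMeasurable ‖hsEquiv _ A‖
      (Filter.Eventually.of_forall fun p => (norm_conjTensor _ A).le)
  calc hsEquiv _ (moment t (ensemble H ν (L + 1)) A)
      = ∫ Θ, hsEquiv _ (conjTensor t (circuit H (e Θ).2 * layer H (e Θ).1) A)
          ∂Measure.pi fun _ : Fin (L + 1) => ν := by
        rw [hsEquiv_moment_ensemble]
        refine integral_congr_ae (Filter.Eventually.of_forall fun Θ => ?_)
        beta_reduce
        rw [circuit_succ]
        rfl
    _ = ∫ p, hsEquiv _ (conjTensor t (circuit H p.2 * layer H p.1) A)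
          ∂ν.prod (Measure.pi fun _ : Fin L => ν) :=
        hmp.integral_comp' (g := fun p : (Fin K → ℝ) × (Fin L → Fin K → ℝ) =>
          hsEquiv _ (conjTensor t (circuit H p.2 * layer H p.1) A))
    _ = _ := by
        rw [integral_prod _ hint]
        refine integral_congr_ae (Filter.Eventually.of_forall fun θ => ?_)
        beta_reduce
        rw [conjCLM_apply, hsEquiv_moment_ensemble]
        simp only [conjTensor_mul]

theorem moment_ensemble_zero : moment t (ensemble H ν 0) = 1 := by
  refine LinearMap.ext fun A => (hsEquiv _).injective ?_
  have h : ∀ Θ : Fin 0 → Fin K → ℝ, circuit H Θ = 1 := fun Θ => by simp [circuit]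
  rw [hsEquiv_moment_ensemble]
  simp [h, conjTensor_one]

theorem moment_ensemble_succ (L : ℕ) :
    moment t (ensemble H ν (L + 1)) = moment t (ensemble H ν L) * moment t (ensemble H ν 1) := by
  refine LinearMap.ext fun A => (hsEquiv _).injective ?_
  have hint : Integrable (fun θ => hsEquiv _ (conjTensor t (layer H θ) A)) ν :=
    Integrable.of_bound ((continuous_hsEquiv_conjTensor A).comp
      (continuous_layer H)).aestronglyMeasurable ‖hsEquiv _ A‖
      (Filter.Eventually.of_forall fun p => (norm_conjTensor _ A).le)
  have h1 : hsEquiv _ (moment t (ensemble H ν 1) A) =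
      ∫ θ, hsEquiv _ (conjTensor t (layer H θ) A) ∂ν := by
    have h := hsEquiv_moment_ensemble_succ H ν 0 A
    rw [moment_ensemble_zero] at h
    simpa only [conjCLM_apply, Module.End.one_apply] using h
  have h2 := (conjCLM (hsEquiv _) (moment t (ensemble H ν L))).integral_comp_comm hint
  rw [hsEquiv_moment_ensemble_succ, h2, ← h1, conjCLM_apply, Module.End.mul_apply]

/-- With `M` the moment operator of a layer and `P` that of the Haar ensemble, `M P = P M = P` and
`P² = P`; hence `(M - P) ^ L = M ^ L - P`. -/
theorem expressiveness_ensemble_eq_pow {L : ℕ} (hL : 1 ≤ L) :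
    expressiveness H t (ensemble H ν L) = expressiveness H t (ensemble H ν 1) ^ L := by
  induction L, hL using Nat.le_induction with
  | base => rw [pow_one]
  | succ L hL ih =>
    rw [pow_succ, ← ih]
    simp only [expressiveness]
    rw [sub_mul, mul_sub, mul_sub, moment_mul_moment_haarEnsemble (ae_mem_dynGroup_ensemble H ν L),
      moment_haarEnsemble_mul_moment (ae_mem_dynGroup_ensemble H ν 1),
      moment_mul_moment_haarEnsemble (ae_mem_dynGroup_haarEnsemble H), moment_ensemble_succ,
      sub_self, sub_zero]

variable {H}

theorem tensorPow_layer (θ : Fin K → ℝ) :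
    tensorPow t (layer H θ : Matrix d d ℂ) = (List.ofFn fun k => NormedSpace.exp
      (θ k • tensorDeriv t (-Complex.I • (H k : Matrix d d ℂ)))).prod := by
  have hgate : ∀ k, NormedSpace.exp (θ k • tensorDeriv t (-Complex.I • (H k : Matrix d d ℂ))) =
      tensorPow t (gate (H k) (θ k) : Matrix d d ℂ) := by
    intro k
    rw [gate, ← exp_tensorDeriv, mul_comm, mul_smul, Complex.coe_smul]
    congr 1
    exact ((tensorDeriv t).restrictScalars ℝ).map_smul _ _ |>.symm
  simp only [hgate]
  have hprod : ∀ l : List (Matrix.unitaryGroup d ℂ), tensorPow t (l.prod : Matrix d d ℂ) =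
      (l.map fun U : Matrix.unitaryGroup d ℂ => tensorPow t (U : Matrix d d ℂ)).prod := by
    intro l
    induction l with
    | nil => simp [tensorPow_one]
    | cons U l ih =>
      rw [List.prod_cons, List.map_cons, List.prod_cons, ← ih, ← tensorPow_mul]
      rfl
  rw [layer, hprod, List.map_ofFn]
  rfl

/-- A matrix that commutes with the generators `i Hₖ` on `t` tensor factors is `G`-invariant: the
elements of the Lie algebra that act trivially on it form a Lie subalgebra, and the group elements
that fix it form a closed subgroup. -/
theorem conjTensor_eq_self_of_commute {A : Matrix (Fin t → d) (Fin t → d) ℂ}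
    (h : ∀ k, Commute (tensorDeriv t (-Complex.I • (H k : Matrix d d ℂ))) A)
    {g : Matrix.unitaryGroup d ℂ} (hg : g ∈ dynGroup H) : conjTensor t g A = A := by
  let 𝔥 : LieSubalgebra ℝ (Matrix d d ℂ) :=
    { carrier := {X | Commute (tensorDeriv t X) A}
      zero_mem' := by simp
      add_mem' := fun {X Y} hX hY => by
        simpa using hX.add_left hY
      smul_mem' := fun c X hX => by
        have : tensorDeriv t (c • X) = c • tensorDeriv t X :=
          ((tensorDeriv t).restrictScalars ℝ).map_smul _ _
        change Commute _ _
        rw [this]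
        exact Commute.smul_left hX c
      lie_mem' := fun {X Y} hX hY => by
        change Commute (tensorDeriv t ⁅X, Y⁆) A
        rw [Ring.lie_def, tensorDeriv_commutator]
        exact (Commute.mul_left hX hY).sub_left (Commute.mul_left hY hX) }
  have hle : dynLie H ≤ 𝔥 := by
    refine LieSubalgebra.lieSpan_le.mpr ?_
    rintro _ ⟨k, rfl⟩
    change Commute (tensorDeriv t _) A
    simpa using (h k).neg_left
  let S : Subgroup (Matrix.unitaryGroup d ℂ) :=
    { carrier := {g | conjTensor t g A = A}
      one_mem' := conjTensor_one A
      mul_mem' := fun {a b} ha hb => by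
        change conjTensor t (a * b) A = A
        rw [conjTensor_mul, show conjTensor t b A = A from hb, show conjTensor t a A = A from ha]
      inv_mem' := fun {a} ha => by
        change conjTensor t a⁻¹ A = A
        conv_lhs => rw [← show conjTensor t a A = A from ha]
        rw [← conjTensor_mul, inv_mul_cancel, conjTensor_one] }
  have hS : IsClosed (S : Set (Matrix.unitaryGroup d ℂ)) := by
    have : (S : Set (Matrix.unitaryGroup d ℂ)) =
        {g | hsEquiv _ (conjTensor t g A) = hsEquiv _ A} :=
      Set.ext fun g => (hsEquiv _).injective.eq_iff.symm
    rw [this]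
    exact isClosed_eq (continuous_hsEquiv_conjTensor A) continuous_const
  have hexp : expSet H ⊆ S := by
    rintro U ⟨X, hX, hU⟩
    refine (conjTensor_eq_iff U A A).mpr ?_
    rw [hU, ← exp_tensorDeriv]
    exact commute_exp_matrix (hle hX)
  exact Subgroup.topologicalClosure_minimal _ ((Subgroup.closure_le _).mpr hexp) hS hg

variable {ν}

/-- The norm of `M - P` is attained at some `X`. If it were at least `1`, then `M` would preserve
the norm of the component `A = X - P X` of `X`, so that `U^{⊗t} A (U†)^{⊗t}` would be constant on
the support of the ensemble. By analyticity, `A` would be `G`-invariant, hence `A = P A = 0`. -/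
theorem superNorm_expressiveness_lt_one [Nonempty d]
    (hν : 0 < volume {θ : Fin K → ℝ | layer H θ ∈ (ensemble H ν 1).support}) :
    superNorm (expressiveness H t (ensemble H ν 1)) < 1 := by
  rw [superNorm, inducedNorm_eq_norm_conjCLM (hsEquiv _) hsNorm_eq_norm_hsEquiv]
  set T := conjCLM (hsEquiv (Fin t → d)) (expressiveness H t (ensemble H ν 1)) with hT
  -- by compactness of the unit sphere, the operator norm is attained
  obtain ⟨v, hv0, hv⟩ : ∃ v, v ≠ 0 ∧ ‖T v‖ = ‖T‖ * ‖v‖ := by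
    obtain ⟨v, hv, hmax⟩ := (isCompact_sphere (0 : EuclideanSpace ℂ ((Fin t → d) × (Fin t → d)))
      1).exists_isMaxOn (NormedSpace.sphere_nonempty.mpr zero_le_one)
      T.continuous.norm.continuousOn
    have hv1 : ‖v‖ = 1 := by simpa using hv
    refine ⟨v, by rintro rfl; simp at hv1, ?_⟩
    rw [hv1, mul_one]
    refine le_antisymm (by simpa [hv1] using T.le_opNorm v) ?_
    refine T.opNorm_le_of_unit_norm (norm_nonneg _) fun w hw => ?_
    exact hmax (by simpa using hw)
  obtain ⟨X, rfl⟩ := (hsEquiv (Fin t → d)).surjective v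
  by_contra! hge
  set M := moment t (ensemble H ν 1) with hM
  set P := moment t (haarEnsemble H) with hP
  have hPX : ∀ g ∈ dynGroup H, conjTensor t g (P X) = P X := fun g hg =>
    conjTensor_moment_haarEnsemble H hg X
  have hPP : P (P X) = P X := moment_haarEnsemble_eq_self hPX
  have hMP : M (P X) = P X := moment_eq_self
    ((ae_mem_dynGroup_ensemble H ν 1).mono fun _ hU => hPX _ hU)
  have hTX : T (hsEquiv _ X) = hsEquiv _ (M (X - P X)) := by
    rw [hT, conjCLM_apply, expressiveness, LinearMap.sub_apply, map_sub M, hMP]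
  have hle : ‖hsEquiv _ X‖ ≤ ‖hsEquiv _ (M (X - P X))‖ := by
    rw [← hTX, hv]
    exact le_mul_of_one_le_left (norm_nonneg _) hge
  have hsupp : ∀ U ∈ (ensemble H ν 1).support, conjTensor t U (X - P X) = M (X - P X) :=
    fun U hU => conjTensor_eq_moment_of_norm_le
      ((norm_sub_moment_haarEnsemble_le X).trans hle) hU
  obtain ⟨-, hcomm⟩ := eq_and_commute_of_volume_pos
    (fun k => tensorDeriv t (-Complex.I • (H k : Matrix d d ℂ))) (X - P X) (M (X - P X))
    (hν.trans_le (measure_mono fun θ hθ => by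
      have h := (conjTensor_eq_iff _ _ _).mp (hsupp _ hθ)
      rw [tensorPow_layer] at h
      exact h))
  have hfix : P (X - P X) = X - P X := moment_haarEnsemble_eq_self fun g hg =>
    conjTensor_eq_self_of_commute hcomm hg
  rw [map_sub, hPP, sub_self] at hfix
  rw [← hfix, map_zero, map_zero, norm_zero] at hle
  exact hv0 (norm_le_zero_iff.mp hle)

theorem isSelfAdjoint_conjCLM_expressiveness {μ : Measure (Matrix.unitaryGroup d ℂ)}
    [IsFiniteMeasure μ] (h : IsHSSelfAdjoint (moment t μ)) :
    IsSelfAdjoint (conjCLM (hsEquiv _) (expressiveness H t μ)) := by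
  rw [ContinuousLinearMap.isSelfAdjoint_iff_isSymmetric]
  intro v w
  obtain ⟨A, rfl⟩ := (hsEquiv (Fin t → d)).surjective v
  obtain ⟨B, rfl⟩ := (hsEquiv (Fin t → d)).surjective w
  have h1 := h A B
  rw [← inner_hsEquiv, ← inner_hsEquiv] at h1
  change inner ℂ (conjCLM (hsEquiv _) (expressiveness H t μ) (hsEquiv _ A)) (hsEquiv _ B) =
    inner ℂ (hsEquiv _ A) (conjCLM (hsEquiv _) (expressiveness H t μ) (hsEquiv _ B))
  rw [conjCLM_apply, conjCLM_apply, expressiveness, LinearMap.sub_apply, LinearMap.sub_apply,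
    map_sub, map_sub, inner_sub_left, inner_sub_right, h1, inner_moment_haarEnsemble_left]

end Circuit

/-! ### The number of layers -/

section Design

variable {d : Type*} [Fintype d] [DecidableEq d] {K t : ℕ}
  {H : Fin K → selfAdjoint (Matrix d d ℂ)}
  {ν : Measure (Fin K → ℝ)} [IsProbabilityMeasure ν]

/-- The matrices as operators of a Euclidean space, which carries the Schatten `∞`-norm. -/
noncomputable def euclideanCLMEquiv (m : Type*) [Fintype m] [DecidableEq m] :
    Matrix m m ℂ ≃ₗ[ℂ] (EuclideanSpace ℂ m →L[ℂ] EuclideanSpace ℂ m) :=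
  (Matrix.toEuclideanCLM (n := m) (𝕜 := ℂ)).toAlgEquiv.toLinearEquiv

theorem schattenInfty_eq_norm {m : Type*} [Fintype m] [DecidableEq m] (A : Matrix m m ℂ) :
    schattenInfty A = ‖euclideanCLMEquiv m A‖ := rfl

/-- The sufficient number of layers, for the superoperator norm induced by any norm `N`. -/
theorem inducedNorm_expressiveness_le [Nonempty d] {V : Type*} [NormedAddCommGroup V]
    [NormedSpace ℂ V] [FiniteDimensional ℂ V] {N : Matrix (Fin t → d) (Fin t → d) ℂ → ℝ}
    (e : Matrix (Fin t → d) (Fin t → d) ℂ ≃ₗ[ℂ] V) (hN : ∀ A, N A = ‖e A‖)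
    (h1 : inducedNorm N (expressiveness H t (ensemble H ν 1)) < 1) {ε : ℝ} {L : ℕ} (hε : 0 < ε)
    (hL : 1 ≤ L)
    (h : Real.log (1 / ε) /
      Real.log (1 / inducedNorm N (expressiveness H t (ensemble H ν 1))) ≤ L) :
    inducedNorm N (expressiveness H t (ensemble H ν L)) ≤ ε := by
  rw [expressiveness_ensemble_eq_pow H ν hL]
  exact (inducedNorm_pow_le e hN _ hL).trans
    (pow_le_of_log_div_log_le (inducedNorm_nonneg_of_norm e hN _) h1 hε hL h)

theorem superNorm_pow_of_isHSSelfAdjoint [Nonempty d] {μ : Measure (Matrix.unitaryGroup d ℂ)}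
    [IsFiniteMeasure μ] (h : IsHSSelfAdjoint (moment t μ)) {L : ℕ} (hL : 1 ≤ L) :
    superNorm (expressiveness H t μ ^ L) = superNorm (expressiveness H t μ) ^ L := by
  rw [superNorm, superNorm, inducedNorm_eq_norm_conjCLM _ hsNorm_eq_norm_hsEquiv,
    inducedNorm_eq_norm_conjCLM _ hsNorm_eq_norm_hsEquiv, conjCLM_pow,
    norm_pow_of_isSelfAdjoint (isSelfAdjoint_conjCLM_expressiveness h) hL]

end Design

end PQC

/-- Qubit systems: the standard basis of `(ℂ²)^{⊗n}` is indexed by `Fin n → Fin 2`. The first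
conjuncts are about the Schatten `∞`-norm of superoperators (largest singular value), the last one
about the norm induced by the Schatten `∞`-norm on matrices, which can be `≥ 1`. -/
theorem theorem2 (n K t : ℕ)
    (H : Fin K → selfAdjoint (Matrix (Fin n → Fin 2) (Fin n → Fin 2) ℂ))
    (ν : MeasureTheory.Measure (Fin K → ℝ)) [MeasureTheory.IsProbabilityMeasure ν]
    (hν : 0 < MeasureTheory.volume
      {θ : Fin K → ℝ | PQC.layer H θ ∈ (PQC.ensemble H ν 1).support}) :
    -- the circuits lie in `G`
    (∀ (L : ℕ) (Θ : Fin L → Fin K → ℝ), PQC.circuit H Θ ∈ PQC.dynGroup H) ∧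
    -- the single-layer norm is smaller than one
    PQC.superNorm (PQC.expressiveness H t (PQC.ensemble H ν 1)) < 1 ∧
    -- the sufficient number of layers
    (∀ (ε : ℝ) (L : ℕ), 0 < ε → 1 ≤ L →
      Real.log (1 / ε) /
          Real.log (1 / PQC.superNorm (PQC.expressiveness H t (PQC.ensemble H ν 1))) ≤ (L : ℝ) →
      PQC.IsApproxDesign H t ε (PQC.ensemble H ν L)) ∧
    -- the expressiveness of `L` layers in terms of that of a single layer
    (∀ L : ℕ, 1 ≤ L →
      PQC.expressiveness H t (PQC.ensemble H ν L) =
          PQC.expressiveness H t (PQC.ensemble H ν 1) ^ L ∧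
      PQC.superNorm (PQC.expressiveness H t (PQC.ensemble H ν L)) ≤
          PQC.superNorm (PQC.expressiveness H t (PQC.ensemble H ν 1)) ^ L ∧
      (PQC.IsHSSelfAdjoint (PQC.moment t (PQC.ensemble H ν 1)) →
        PQC.superNorm (PQC.expressiveness H t (PQC.ensemble H ν L)) =
          PQC.superNorm (PQC.expressiveness H t (PQC.ensemble H ν 1)) ^ L)) ∧
    -- the sufficient number of layers for the induced norm
    (PQC.superNormInd (PQC.expressiveness H t (PQC.ensemble H ν 1)) < 1 →
      ∀ (ε : ℝ) (L : ℕ), 0 < ε → 1 ≤ L →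
        Real.log (1 / ε) /
            Real.log (1 / PQC.superNormInd (PQC.expressiveness H t (PQC.ensemble H ν 1))) ≤ (L : ℝ) →
        PQC.superNormInd (PQC.expressiveness H t (PQC.ensemble H ν L)) ≤ ε) := by
  have hlt := PQC.superNorm_expressiveness_lt_one (t := t) hν
  refine ⟨fun L Θ => PQC.circuit_mem_dynGroup H Θ, hlt, fun ε L hε hL h =>
    PQC.inducedNorm_expressiveness_le _ PQC.hsNorm_eq_norm_hsEquiv hlt hε hL h, fun L hL => ?_,
    fun h1 ε L hε hL h =>
      PQC.inducedNorm_expressiveness_le _ PQC.schattenInfty_eq_norm h1 hε hL h⟩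
  rw [PQC.expressiveness_ensemble_eq_pow H ν hL]
  exact ⟨rfl, PQC.inducedNorm_pow_le _ PQC.hsNorm_eq_norm_hsEquiv _ hL,
    fun h => PQC.superNorm_pow_of_isHSSelfAdjoint h hL⟩
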